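/- Let $\mathscr{A}$ be an abelian length category, that is, an abelian category in which every object has finite length (its subobjects satisfy both the ascending and the descending chain condition); $\mathscr{A}$ is not assumed to have enough projectives. Let $A$ be an object of $\mathscr{A}$ whose endomorphism ring $\mathrm{End}(A)$ is artinian as an abelian group (i.e. satisfies the descending chain condition on subgroups). Let $F : \mathscr{A} \to \mathrm{Ab}$ be a functor that is a direct summand of the functor $\mathrm{Ext}^{1}(A,-) : \mathscr{A} \to \mathrm{Ab}$, i.e. there are natural transformations $\iota : F \to \mathrm{Ext}^{1}(A,-)$ and $\pi : \mathrm{Ext}^{1}(A,-) \to F$ with $\pi\iota = 1_F$. Then there is a subobject $B$ of $A$ such that $F \simeq \mathrm{Ext}^{1}(B,-)$, naturally as functors $\mathscr{A} \to \mathrm{Ab}$. -/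

import Mathlib

universe w v u

open CategoryTheory CategoryTheory.Abelian

/-- A length category: every object has finite length, that is, its subobjects satisfy both the
ascending and the descending chain condition. -/
def IsLengthCategory (C : Type*) [Category* C] : Prop :=
  ∀ X : C, IsNoetherianObject X ∧ IsArtinianObject X

/-- `F` is a direct summand of `G`: the identity of `F` factors through `G`, as a morphism
`F ⟶ G` followed by a morphism `G ⟶ F`. -/
def IsDirectSummand {D : Type*} [Category* D] (F G : D) : Prop :=
  ∃ (i : F ⟶ G) (p : G ⟶ F), i ≫ p = 𝟙 F

/-! The idempotent `p ≫ i` of `Ext¹(A,-)` is induced by some `f : A ⟶ A`. On one class this holds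
because the class is a pushout of the class of a short exact sequence, by effaceability of `Ext`, so
no projectives are needed (`exists_app_eq_mk₀_comp`). The chain condition on `End A` then gives one
`f` for all classes (`exists_forall_app_eq_mk₀_comp`). Such an `f` need not be idempotent, but all
its positive powers induce `p ≫ i`. By Fitting's lemma one of them restricts to an automorphism of
its image `B`; hence the idempotent splits through `Ext¹(B,-)`, and `F ≅ Ext¹(B,-)`. -/

open Limits DerivedCategory

namespace CategoryTheory

/-- If the idempotent of a direct summand `F` of `G` factors through `H` in such a way that the
reverse composition is invertible, then `F` is isomorphic to `H`. -/
theorem isIso_comp_of_comp_eq_idempotent {D : Type*} [Category* D] {F G H : D} {i : F ⟶ G}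
    {p : G ⟶ F} {m : G ⟶ H} {q : H ⟶ G} (hip : i ≫ p = 𝟙 F) (hmq : m ≫ q = p ≫ i)
    [IsIso (q ≫ m)] : IsIso (i ≫ m) := by
  have hsplit : (i ≫ m) ≫ q ≫ p = 𝟙 F := by
    simp only [Category.assoc, reassoc_of% hmq, reassoc_of% hip, hip]
  have hsq : (q ≫ p) ≫ i ≫ m = (q ≫ m) ≫ q ≫ m := by
    simp only [Category.assoc, reassoc_of% hmq]
  have : IsIso ((q ≫ p) ≫ i ≫ m) := by rw [hsq]; infer_instance
  have : IsSplitMono (i ≫ m) := IsSplitMono.mk' ⟨q ≫ p, hsplit⟩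
  have : Epi (i ≫ m) := epi_of_epi (q ≫ p) (i ≫ m)
  exact isIso_of_epi_of_isSplitMono _

section Fitting

variable {C : Type u} [Category.{v} C]

/-- A monomorphism from an artinian object to itself is an isomorphism. -/
theorem isIso_of_mono_of_isArtinianObject {X : C} [IsArtinianObject X] (f : End X)
    [Mono (f : X ⟶ X)] : IsIso (f : X ⟶ X) := by
  have hpow : ∀ n : ℕ, Mono ((f ^ n : End X) : X ⟶ X) := by
    intro n
    induction n with
    | zero => rw [pow_zero]; exact inferInstanceAs (Mono (𝟙 X))
    | succ n ih => rw [pow_succ]; exact mono_comp (f : X ⟶ X) ((f ^ n : End X) : X ⟶ X)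
  have hstep (n : ℕ) : ((f ^ (n + 1) : End X) : X ⟶ X) = f ≫ (f ^ n : End X) := pow_succ f n
  obtain ⟨n, hn⟩ := antitone_chain_condition_of_isArtinianObject
    (⟨fun n => OrderDual.toDual (Subobject.mk ((f ^ n : End X) : X ⟶ X)),
      monotone_nat_of_le_succ fun n => Subobject.mk_le_mk_of_comm f (hstep n).symm⟩ :
      ℕ →o (Subobject X)ᵒᵈ)
  have hle : Subobject.mk ((f ^ n : End X) : X ⟶ X) ≤
      Subobject.mk ((f ^ (n + 1) : End X) : X ⟶ X) :=
    (OrderDual.toDual.injective (hn (n + 1) n.le_succ)).le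
  have hu := Subobject.ofMkLEMk_comp hle
  have : IsSplitEpi (f : X ⟶ X) := IsSplitEpi.mk' ⟨Subobject.ofMkLEMk _ _ hle, by
    have := hpow n
    rw [← cancel_mono ((f ^ n : End X) : X ⟶ X), Category.assoc, ← hstep, hu, Category.id_comp]⟩
  exact isIso_of_mono_of_isSplitEpi _

variable [Abelian C]

/-- Fitting's lemma: a positive power of an endomorphism of an object of finite length restricts to
an automorphism of its image. -/
theorem exists_isIso_arrow_comp_factorThruImageSubobject_pow {X : C} [IsNoetherianObject X]
    [IsArtinianObject X] (f : End X) :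
    ∃ n : ℕ, IsIso ((imageSubobject ((f ^ (n + 1) : End X) : X ⟶ X)).arrow ≫
      factorThruImageSubobject ((f ^ (n + 1) : End X) : X ⟶ X)) := by
  obtain ⟨n, hn⟩ := monotone_chain_condition_of_isNoetherianObject
    (⟨fun n => kernelSubobject ((f ^ n : End X) : X ⟶ X), monotone_nat_of_le_succ fun n => by
      rw [show ((f ^ (n + 1) : End X) : X ⟶ X) = (f ^ n : End X) ≫ f from pow_succ' f n]
      exact kernelSubobject_comp_le _ _⟩ : ℕ →o Subobject X)
  refine ⟨n, ?_⟩
  set g : X ⟶ X := (f ^ (n + 1) : End X) with hg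
  have hker : kernelSubobject (g ≫ g) = kernelSubobject g := by
    have h₂ : g ≫ g = ((f ^ (n + 1 + (n + 1)) : End X) : X ⟶ X) := (pow_add f _ _).symm
    rw [h₂]
    exact (hn (n + 1 + (n + 1)) (by omega)).symm.trans (hn (n + 1) (by omega))
  have hfac := imageSubobject_arrow_comp g
  -- The image of `g` meets `ker g` trivially: if `y ≫ g` is killed by `g`, then `y` lies in `ker g²
  -- = ker g`.
  have : Mono ((imageSubobject g).arrow ≫ factorThruImageSubobject g) := by
    refine Preadditive.mono_of_cancel_zero _ fun {Z} z hz => ?_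
    obtain ⟨Z', q, _, y, hy⟩ := surjective_up_to_refinements_of_epi (factorThruImageSubobject g) z
    have hyg : y ≫ g ≫ g = 0 := by
      rw [← hfac]
      simp only [Category.assoc]
      rw [← reassoc_of% hy, reassoc_of% hz, zero_comp, comp_zero]
    have hy0 : y ≫ g = 0 := by
      apply (kernelSubobject_factors_iff g y).1
      rw [← hker]
      exact kernelSubobject_factors _ _ hyg
    have hy1 : y ≫ factorThruImageSubobject g = 0 := by
      rw [← cancel_mono (imageSubobject g).arrow, Category.assoc, hfac, hy0, zero_comp]
    rw [← cancel_epi q, hy, hy1, comp_zero]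
  have := isArtinianObject_of_mono (imageSubobject g).arrow
  exact isIso_of_mono_of_isArtinianObject
    (((imageSubobject g).arrow ≫ factorThruImageSubobject g : _ ⟶ _) : End (imageSubobject g : C))

end Fitting

variable {C : Type u} [Category.{v} C] [Abelian C]

/-- A morphism in the derived category from an object in degree `0` to a complex in negative
degrees vanishes on the source of some epimorphism. -/
theorem exists_epi_singleFunctor_map_comp_eq_zero [HasDerivedCategory.{w} C] {A : C}
    {L : CochainComplex C ℤ} (n : ℤ) (hn : n < 0) [L.IsStrictlyLE n]
    (φ : Q.obj ((CochainComplex.singleFunctor C 0).obj A) ⟶ Q.obj L) :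
    ∃ (P : C) (p : P ⟶ A), Epi p ∧ Q.map ((CochainComplex.singleFunctor C 0).map p) ≫ φ = 0 := by
  obtain ⟨K, _, s, _, g, rfl⟩ := right_fac_of_isStrictlyLE φ 0
  -- In the roof `A ← K → L`, `K` ends in degree `0`, so `K.X 0` maps to it as a complex. The
  -- required `p` is `s` in degree `0`, and `σ ≫ g` vanishes because `L` is zero there.
  let σ : (CochainComplex.singleFunctor C 0).obj (K.X 0) ⟶ K :=
    HomologicalComplex.mkHomFromSingle (𝟙 _) fun k hk =>
      (K.isZero_of_isStrictlyLE 0 k (by simp at hk; omega)).eq_of_tgt _ _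
  obtain ⟨p, hp⟩ := (CochainComplex.singleFunctor C 0).map_surjective (σ ≫ s)
  refine ⟨K.X 0, p, Preadditive.epi_of_cancel_zero _ fun {Z} q hq => ?_, ?_⟩
  · have hsq : s ≫ (CochainComplex.singleFunctor C 0).map q = 0 := by
      apply HomologicalComplex.to_single_hom_ext
      have h := HomologicalComplex.congr_hom
        (show σ ≫ s ≫ (CochainComplex.singleFunctor C 0).map q = 0 by
          rw [← Category.assoc, ← hp, ← Functor.map_comp, hq, Functor.map_zero]) 0
      rw [HomologicalComplex.comp_f, HomologicalComplex.mkHomFromSingle_f, Category.comp_id] at h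
      rw [HomologicalComplex.zero_f] at h ⊢
      exact (cancel_epi (HomologicalComplex.singleObjXSelf (ComplexShape.up ℤ) 0 (K.X 0)).hom).1
        (h.trans comp_zero.symm)
    apply (singleFunctor C 0).map_injective
    rw [Functor.map_zero]
    change Q.map ((CochainComplex.singleFunctor C 0).map q) = 0
    rw [← cancel_epi (Q.map s), ← Functor.map_comp, hsq, Functor.map_zero, comp_zero]
  · have hσ : σ ≫ g = 0 := HomologicalComplex.from_single_hom_ext
      ((L.isZero_of_isStrictlyLE n 0 hn).eq_of_tgt _ _)
    rw [hp, Functor.map_comp, Category.assoc, IsIso.hom_inv_id_assoc, ← Functor.map_comp, hσ,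
      Functor.map_zero]

namespace Abelian

variable [HasExt.{w} C]

namespace Ext

/-- `Ext` groups of positive degree are effaceable in the first variable. -/
theorem exists_epi_mk₀_comp_eq_zero {A Y : C} {n : ℕ} (x : Ext A Y (n + 1)) :
    ∃ (P : C) (p : P ⟶ A), Epi p ∧ (mk₀ p).comp x (zero_add _) = 0 := by
  let := HasDerivedCategory.standard C
  obtain ⟨P, p, hp, h⟩ := exists_epi_singleFunctor_map_comp_eq_zero
    (L := (CochainComplex.singleFunctor C (-(n + 1))).obj Y) (-(n + 1)) (by omega)
    (x.hom ≫ ((singleFunctors C).shiftIso (n + 1) (-(n + 1)) 0 (by lia)).hom.app Y)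
  refine ⟨P, p, hp, ?_⟩
  ext
  rw [comp_hom, mk₀_hom, ShiftedHom.mk₀_comp, zero_hom,
    ← cancel_mono (((singleFunctors C).shiftIso (n + 1) (-(n + 1)) 0 (by lia)).hom.app Y),
    Category.assoc, Limits.zero_comp]
  exact h

/-- Every class in `Ext¹` is the pushout of the class of a short exact sequence. -/
theorem exists_extClass_comp_mk₀_eq {A Y : C} (x : Ext A Y 1) :
    ∃ (N P : C) (i : N ⟶ P) (p : P ⟶ A) (w : i ≫ p = 0) (hS : (ShortComplex.mk i p w).ShortExact)
      (f : N ⟶ Y), hS.extClass.comp (mk₀ f) (add_zero 1) = x := by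
  obtain ⟨P, p, _, hp⟩ := exists_epi_mk₀_comp_eq_zero x
  have hS : (ShortComplex.mk (kernel.ι p) p (kernel.condition p)).ShortExact :=
    { exact := ShortComplex.exact_kernel p }
  obtain ⟨f, hf⟩ := contravariant_sequence_exact₃ hS Y x hp (add_zero 1)
  obtain ⟨f, rfl⟩ := (mk₀_bijective _ _).2 f
  exact ⟨_, _, _, _, _, hS, f, hf⟩

end Ext

variable {A B : C}

/-- The components of a natural transformation between covariant `Ext` functors. -/
noncomputable def extAppHom {n : ℕ} (e : extFunctorObj.{w} B n ⟶ extFunctorObj A n) (Y : C) :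
    Ext B Y n →+ Ext A Y n :=
  (e.app Y).hom

theorem extAppHom_comp_mk₀ {n : ℕ} (e : extFunctorObj.{w} B n ⟶ extFunctorObj A n) {Y Z : C}
    (f : Y ⟶ Z) (y : Ext B Y n) :
    extAppHom e Z (y.comp (Ext.mk₀ f) (add_zero n)) =
      (extAppHom e Y y).comp (Ext.mk₀ f) (add_zero n) :=
  DFunLike.congr_fun (congrArg AddCommGrpCat.Hom.hom (e.naturality f)) y

/-- A natural transformation between covariant `Ext¹` functors agrees, on each single class, with
the pullback along some morphism. -/
theorem exists_app_eq_mk₀_comp (e : extFunctorObj.{w} B 1 ⟶ extFunctorObj A 1) {Y : C}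
    (x : Ext B Y 1) :
    ∃ h : A ⟶ B, extAppHom e Y x = (Ext.mk₀ h).comp x (zero_add 1) := by
  obtain ⟨N, P, i, p, w, hS, f, rfl⟩ := Ext.exists_extClass_comp_mk₀_eq x
  -- Pushing out along `i` kills the class of the sequence, hence by naturality its image under `e`,
  -- which therefore comes from `Hom(A, B)`.
  obtain ⟨h, hh⟩ := Ext.covariant_sequence_exact₁ A hS (extAppHom e N hS.extClass)
    (by
      rw [← extAppHom_comp_mk₀]
      exact (congrArg _ hS.extClass_comp).trans (map_zero _)) (zero_add 1)
  obtain ⟨h, rfl⟩ := (Ext.mk₀_bijective _ _).2 h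
  refine ⟨h, ?_⟩
  rw [extAppHom_comp_mk₀, ← hh, Ext.comp_assoc]
  all_goals lia

/-- The morphisms `A ⟶ B` which pull back a given class in `Ext¹` to zero. -/
noncomputable def pullbackAnnihilator (A : C) {Y : C} (x : Ext B Y 1) : Submodule ℤ (A ⟶ B) :=
  AddSubgroup.toIntSubmodule (AddMonoidHom.ker
    (AddMonoidHom.mk' (fun h : A ⟶ B => (Ext.mk₀ h).comp x (zero_add 1))
      fun h h' => by rw [Ext.mk₀_add, Ext.add_comp]))

theorem mem_pullbackAnnihilator {Y : C} {x : Ext B Y 1} {h : A ⟶ B} :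
    h ∈ pullbackAnnihilator A x ↔ (Ext.mk₀ h).comp x (zero_add 1) = 0 :=
  Iff.rfl

/-- If the group of morphisms `A ⟶ B` is artinian, then every natural transformation between the
covariant `Ext¹` functors of `B` and `A` is the pullback along a morphism `A ⟶ B`. -/
theorem exists_forall_app_eq_mk₀_comp [IsArtinian ℤ (A ⟶ B)]
    (e : extFunctorObj.{w} B 1 ⟶ extFunctorObj A 1) :
    ∃ h : A ⟶ B, ∀ (Y : C) (x : Ext B Y 1), extAppHom e Y x = (Ext.mk₀ h).comp x (zero_add 1) := by
  obtain ⟨_, ⟨⟨Y₀, x₀⟩, rfl⟩, hmin⟩ := IsArtinian.set_has_minimal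
    (Set.range fun s : (Σ Y : C, Ext B Y 1) => pullbackAnnihilator A s.2) ⟨_, ⟨⟨B, 0⟩, rfl⟩⟩
  obtain ⟨h, hh⟩ := exists_app_eq_mk₀_comp e x₀
  refine ⟨h, fun Y x => ?_⟩
  -- A morphism killing `z` kills both `x₀` and `x`; minimality makes the annihilators of `z` and
  -- `x₀` equal. Since `h` and `h'` agree on `x₀`, they agree on `z`, hence on `x`.
  let z : Ext B (Y₀ ⊞ Y) 1 :=
    x₀.comp (Ext.mk₀ biprod.inl) (add_zero 1) + x.comp (Ext.mk₀ biprod.inr) (add_zero 1)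
  have hz₁ : z.comp (Ext.mk₀ biprod.fst) (add_zero 1) = x₀ := by
    simp [z, Ext.add_comp]
  have hz₂ : z.comp (Ext.mk₀ biprod.snd) (add_zero 1) = x := by
    simp [z, Ext.add_comp]
  obtain ⟨h', hh'⟩ := exists_app_eq_mk₀_comp e z
  have hof {T : C} (f : Y₀ ⊞ Y ⟶ T) :
      extAppHom e T (z.comp (Ext.mk₀ f) (add_zero 1)) =
        (Ext.mk₀ h').comp (z.comp (Ext.mk₀ f) (add_zero 1)) (zero_add 1) := by
    rw [extAppHom_comp_mk₀, hh', Ext.comp_assoc]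
    all_goals lia
  have hle : pullbackAnnihilator A z ≤ pullbackAnnihilator A x₀ := fun k hk => by
    rw [mem_pullbackAnnihilator] at hk ⊢
    rw [← hz₁, ← Ext.comp_assoc (a₁₂ := 1) _ _ _ (by lia) (by lia) (by lia), hk, Ext.zero_comp]
  have hmem : h - h' ∈ pullbackAnnihilator A z := by
    rw [hle.eq_of_not_lt (hmin _ ⟨⟨_, z⟩, rfl⟩), mem_pullbackAnnihilator, sub_eq_add_neg,
      Ext.mk₀_add, Ext.mk₀_neg, Ext.add_comp, Ext.neg_comp, ← hh]
    have := hof biprod.fst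
    rw [hz₁] at this
    rw [this, add_neg_cancel]
  rw [mem_pullbackAnnihilator, sub_eq_add_neg, Ext.mk₀_add, Ext.mk₀_neg, Ext.add_comp,
    Ext.neg_comp, add_neg_eq_zero] at hmem
  have := hof biprod.snd
  rw [hz₂] at this
  rw [this, ← hz₂, ← Ext.comp_assoc (a₁₂ := 1) _ _ _ (by lia) (by lia) (by lia), ← hmem,
    Ext.comp_assoc]
  all_goals lia

end Abelian

end CategoryTheory

theorem corollary4p7 {C : Type u} [Category.{v} C] [Abelian C] [HasExt.{w} C]
    (hC : IsLengthCategory C) (A : C) (hA : IsArtinian ℤ (End A))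
    (F : C ⥤ AddCommGrpCat.{w}) (hF : IsDirectSummand F (extFunctorObj A 1)) :
    ∃ B : Subobject A, Nonempty (F ≅ extFunctorObj (B : C) 1) := by
  obtain ⟨i, p, hip⟩ : IsDirectSummand F ((extFunctor.{w} 1).obj (Opposite.op A)) := hF
  have := (hC A).1
  have := (hC A).2
  have : IsArtinian ℤ (A ⟶ A) := hA
  obtain ⟨f, hf⟩ := exists_forall_app_eq_mk₀_comp (p ≫ i)
  have hfmap : p ≫ i = (extFunctor 1).map f.op := by
    ext Y x
    exact hf Y x
  -- The exponent is `n + 1` because the zeroth power induces the identity, not the idempotent.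
  have hpow (n : ℕ) :
      p ≫ i = (extFunctor 1).map (Quiver.Hom.op (End.asHom ((End.of f) ^ (n + 1)))) := by
    induction n with
    | zero => rw [hfmap, zero_add, pow_one]
    | succ n ih =>
      have h : p ≫ i = (p ≫ i) ≫ p ≫ i := by simp [reassoc_of% hip]
      refine h.trans ((congrArg₂ (· ≫ ·) ih hfmap).trans ?_)
      rw [← Functor.map_comp, ← op_comp, pow_succ]
      rfl
  obtain ⟨n, hn⟩ := exists_isIso_arrow_comp_factorThruImageSubobject_pow (End.of f)
  have he := hpow n
  set g : A ⟶ A := End.asHom ((End.of f) ^ (n + 1))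
  let m := (extFunctor.{w} (C := C) 1).map (imageSubobject g).arrow.op
  let q := (extFunctor.{w} (C := C) 1).map (factorThruImageSubobject g).op
  have hmq : m ≫ q = p ≫ i := by
    rw [he, ← Functor.map_comp, ← op_comp, imageSubobject_arrow_comp]
  have hqm : IsIso (q ≫ m) := by
    have : q ≫ m = (extFunctor.{w} (C := C) 1).map
        ((imageSubobject g).arrow ≫ factorThruImageSubobject g).op := by
      rw [op_comp, Functor.map_comp]
    rw [this]
    have : IsIso ((imageSubobject g).arrow ≫ factorThruImageSubobject g) := hn
    infer_instance
  have := isIso_comp_of_comp_eq_idempotent hip hmq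
  let φ : F ≅ (extFunctor.{w} 1).obj (Opposite.op (imageSubobject g : C)) := asIso (i ≫ m)
  exact ⟨imageSubobject g, ⟨φ⟩⟩
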